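/- **Setting.** Let $\Gamma$ be a finite tree with vertex set $\mathcal V$, all genera zero, and Euler decorations $e_v\in\mathbb Z$, whose intersection form on $L=\mathbb Z\langle E_v\rangle_{v\in\mathcal V}$ (given by $(E_v,E_v)=e_v$, and for $v\ne w$ by $(E_v,E_w)=1$ if $v,w$ are adjacent and $0$ otherwise) is negative definite. Let $L'=\{x\in L\otimes\mathbb Q:(x,L)\subset\mathbb Z\}$, ordered coordinatewise, let $[x]$ be the class of $x\in L'$ in $L'/L$, let $E^*_v\in L'$ be defined by $(E^*_v,E_w)=-\delta_{vw}$ (Kronecker symbol), let $E=\sum_vE_v$, let $Z_K\in L'$ be defined by $(Z_K,E_v)=e_v+2$ for all $v$, and let $\chi(x)=-(x,x-Z_K)/2$. For a cycle $x=\sum_vx_vE_v$ let $|x|=\{v:x_v\neq0\}$. Assume that $\Gamma$ is an elliptic graph: $\min_{l\in L,\,l>0}\chi(l)=0$, and $\Gamma$ is the graph of a minimal resolution, i.e. $e_v\le-2$ for all $v$. **Canonical polynomial.** Let $\delta_v$ be the valency of $v$, let $Z(\mathbf t)=\sum_{l'\in L'}z(l')\mathbf t^{l'}$ be the Taylor expansion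 at the origin of $\prod_v(1-\mathbf t^{E^*_v})^{\delta_v-2}$, and let $Z_{[Z_K]}(\mathbf t)=\sum_{[l']=[Z_K]}z(l')\mathbf t^{l'}$. Write $\mathbf t^{Z_K-E}Z_{[Z_K]}(\mathbf t^{-1})=\sum_\ell w(\ell)\mathbf t^\ell$, and let $P_0(\mathbf t)=\sum w(\ell)\mathbf t^\ell$, the sum being over those $\ell$ with $\ell_v\ge0$ for at least one $v$. Let $\mathrm{Supp}(P_0)$ be the set of exponents of $P_0$ with non-zero coefficient. For $\ell\in\mathrm{Supp}(P_0)$ let $\mathcal V^{<0}(\ell)=\{v:\ell_v<0\}$. The cycle associated with $\ell$ is the unique $l'\in L'$ with $[l']=[Z_K]$ such that $$\ell=Z_K-E-l'-\sum_{v\in\mathcal V^{<0}(\ell)}m_vE_v$$ for some $m_v\in\mathbb Z_{\ge0}$, $l'\le Z_K$, and $l'_v=(Z_K)_v$ for all $v\in\mathcal V^{<0}(\ell)$. **Nagy–Némethi elliptic sequence.** Let $s_{[Z_K]}$ be the minimum of $\{x\in L':[x]=[Z_K],\ (x,E_v)\le0\ \forall v\}$. For the full subgraph on a vertex set $B$,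 let $Z_{min}(B)$ be the minimum of the non-zero effective $l\in L$ with $|l|\subseteq B$ and $(l,E_v)\le0$ for all $v\in B$. Put $B_{-1}=\Gamma$, $Z_{B_{-1}}=s_{[Z_K]}$, and, for $j\ge0$, $B_j=|Z_K-\sum_{i=-1}^{j-1}Z_{B_i}|$, $Z_{B_j}=Z_{min}(B_j)$. The sequence stops at the first index $m\ge0$ with $Z_{B_m}=Z_K-\sum_{i=-1}^{m-1}Z_{B_i}$. Let $C_j=\sum_{i=-1}^jZ_{B_i}$, and let $\mathrm{Supp}_j(P_0)$ be the set of those $\ell\in\mathrm{Supp}(P_0)$ whose associated cycle is $C_j$. **Theorem.** Let $\Gamma$ be an elliptic graph. 1. Every $\ell\in\mathrm{Supp}(P_0)$ has a unique associated cycle, and it belongs to $\{C_{-1},C_0,\dots,C_{m-1}\}$. 2. For every $j\in\{-1,\dots,m-1\}$ and every $\ell\in\mathrm{Supp}_j(P_0)$ one has $\mathcal V^{<0}(\ell)=\Gamma\setminus B_{j+1}$. 3. Consequently $\mathrm{Supp}(P_0)=\bigsqcup_{j=-1}^{m-1}\mathrm{Supp}_j(P_0)$, a disjoint union. -/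

import Mathlib

open scoped Matrix

/-- The intersection matrix of a simple graph with Euler decorations `e`: the diagonal entries are
`e v`, the off-diagonal ones are `1` for adjacent vertices and `0` otherwise. -/
noncomputable def intersectionMatrix {V : Type*} [DecidableEq V] (G : SimpleGraph V) (e : V → ℤ) :
    Matrix V V ℚ := by
  classical
  exact fun v w => if v = w then (e v : ℚ) else if G.Adj v w then 1 else 0

/-- A connected negative definite plumbing graph whose plumbed 3-manifold is a rational homology
sphere: a (finite) tree with Euler decorations (all genera are zero) and negative definite
intersection form. -/
structure PlumbingTree (V : Type*) [Fintype V] [DecidableEq V] where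
  graph : SimpleGraph V
  isTree : graph.IsTree
  /-- the Euler decoration `e v = (E_v, E_v)` -/
  e : V → ℤ
  negDef : ∀ x : V → ℚ, x ≠ 0 → x ⬝ᵥ (intersectionMatrix graph e *ᵥ x) < 0

namespace PlumbingTree

variable {V : Type*} [Fintype V] [DecidableEq V] (Γ : PlumbingTree V)

/-- The intersection form on `L ⊗ ℚ`; the rational cycle `∑ v, x v • E_v` is the vector
`x : V → ℚ`. -/
noncomputable def form (x y : V → ℚ) : ℚ := x ⬝ᵥ (intersectionMatrix Γ.graph Γ.e *ᵥ y)

/-- The base element `E_v`. -/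
def baseE (_Γ : PlumbingTree V) (v : V) : V → ℚ := Pi.single v 1

/-- The reduced cycle `E = ∑ v, E_v`. -/
def sumE : V → ℚ := ∑ v, Γ.baseE v

/-- The lattice `L = ℤ⟨E_v⟩`. -/
def L (_Γ : PlumbingTree V) : AddSubgroup (V → ℚ) :=
  AddMonoidHom.range ((Int.castAddHom ℚ).compLeft V)

/-- The dual lattice `L'`, inside `L ⊗ ℚ`. Two of its elements have the same class in `H = L' / L`
when their difference lies in `L`. -/
def L' : AddSubgroup (V → ℚ) where
  carrier := {x | ∀ y ∈ Γ.L, ∃ n : ℤ, Γ.form x y = n}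
  zero_mem' := fun y _ => ⟨0, by simp [form]⟩
  add_mem' := fun {a b} ha hb y hy => by
    obtain ⟨n, hn⟩ := ha y hy
    obtain ⟨k, hk⟩ := hb y hy
    refine ⟨n + k, ?_⟩
    simp only [form, add_dotProduct] at *
    rw [hn, hk]; push_cast; rfl
  neg_mem' := fun {a} ha y hy => by
    obtain ⟨n, hn⟩ := ha y hy
    refine ⟨-n, ?_⟩
    simp only [form, neg_dotProduct] at *
    rw [hn]; push_cast; rfl

/-- The support `|x|` of a cycle. -/
def supp (_Γ : PlumbingTree V) (x : V → ℚ) : Set V := {v | x v ≠ 0}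

/-- The (anti)dual base element `E*_v`, characterized by `form_dualE` below. -/
noncomputable def dualE (v : V) : V → ℚ :=
  fun w => -(intersectionMatrix Γ.graph Γ.e)⁻¹ v w

theorem isUnit_det : IsUnit (intersectionMatrix Γ.graph Γ.e).det := by
  rw [isUnit_iff_ne_zero]
  intro h
  obtain ⟨x, hx, hx0⟩ := Matrix.exists_mulVec_eq_zero_iff.mpr h
  have := Γ.negDef x hx
  simp [hx0] at this

theorem form_dualE (v w : V) : Γ.form (Γ.dualE v) (Γ.baseE w) = if v = w then -1 else 0 := by
  have h := congrFun (congrFun (Matrix.nonsing_inv_mul _ Γ.isUnit_det) v) w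
  rw [Matrix.mul_apply, Matrix.one_apply] at h
  have h2 : Γ.form (Γ.dualE v) (Γ.baseE w) = -(if v = w then 1 else 0) := by
    rw [← h]
    simp [form, dualE, baseE, dotProduct, Finset.sum_neg_distrib]
  rw [h2]
  split_ifs <;> simp

/-- The anti-canonical cycle `Z_K`, characterized by the adjunction formulae
`form_canonicalCycle` below. -/
noncomputable def canonicalCycle : V → ℚ := ∑ v, (-((Γ.e v : ℚ) + 2)) • Γ.dualE v

theorem form_canonicalCycle (v : V) :
    Γ.form Γ.canonicalCycle (Γ.baseE v) = (Γ.e v : ℚ) + 2 := by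
  have h : ∀ w, Γ.dualE w ⬝ᵥ (intersectionMatrix Γ.graph Γ.e *ᵥ Γ.baseE v)
      = if w = v then -1 else 0 := fun w => Γ.form_dualE w v
  simp [form, canonicalCycle, sum_dotProduct, h]

/-- The Riemann–Roch function `χ(x) = -(x, x - Z_K) / 2`. -/
noncomputable def chi (x : V → ℚ) : ℚ := -Γ.form x (x - Γ.canonicalCycle) / 2

/-- An elliptic graph: `min χ = 0` over the effective non-zero integral cycles, and the graph is
the dual graph of a minimal resolution, i.e. there is no (rational) `(-1)`-curve. -/
def IsElliptic : Prop :=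
  IsLeast (Γ.chi '' {l | l ∈ Γ.L ∧ 0 < l}) 0 ∧ ∀ v, Γ.e v ≤ -2

/-! ### The topological Poincaré series and the canonical polynomial -/

open Classical in
/-- The valency `δ_v`. -/
noncomputable def valency (v : V) : ℕ := Γ.graph.degree v

/-- The Taylor expansion at the origin of `∏ v, (1 - y_v) ^ (δ_v - 2)`, in independent variables
`y_v`. (Of the two truncated natural exponents at most one is non-zero.) -/
noncomputable def zetaSeries : MvPowerSeries V ℤ :=
  ∏ v, ((1 - MvPowerSeries.X v) ^ (Γ.valency v - 2) *
    (MvPowerSeries.invOfUnit (1 - MvPowerSeries.X v) 1) ^ (2 - Γ.valency v))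

/-- The coefficient `z(l')` of the topological Poincaré series
`Z(t) = ∏ v, (1 - t ^ {E*_v}) ^ (δ_v - 2)`, got by substituting `y_v = t ^ {E*_v}` in
`zetaSeries`. The sum is over all `a` with `∑ v, a v • E*_v = l'`; there is at most one such `a`,
because the `E*_v` are linearly independent. -/
noncomputable def poincareCoeff (l' : V → ℚ) : ℤ :=
  ∑ᶠ a ∈ {a : V →₀ ℕ | ∑ v, (a v : ℚ) • Γ.dualE v = l'}, MvPowerSeries.coeff a Γ.zetaSeries

open Classical in
/-- The coefficient at `l'` of `Z_{[h]}(t)`, the part of `Z(t)` of class `[h] ∈ L' / L`. -/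
noncomputable def poincareCoeffClass (h l' : V → ℚ) : ℤ :=
  if l' - h ∈ Γ.L then Γ.poincareCoeff l' else 0

/-- `w(ℓ)`, the coefficient at `ℓ` of `t ^ {Z_K - E} Z_{[Z_K]}(t⁻¹)`. -/
noncomputable def dualCoeff (l : V → ℚ) : ℤ :=
  Γ.poincareCoeffClass Γ.canonicalCycle (Γ.canonicalCycle - Γ.sumE - l)

open Classical in
/-- The coefficient at `ℓ` of the canonical polynomial
`P_0(t) = ∑_{ℓ ⊀ 0} w(ℓ) t ^ ℓ`, where `ℓ ≺ 0` means `ℓ_v < 0` for all `v`. -/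
noncomputable def canonicalPolyCoeff (l : V → ℚ) : ℤ :=
  if ∀ v, l v < 0 then 0 else Γ.dualCoeff l

/-- `Supp(P_0)`, the set of exponents of the canonical polynomial. -/
def suppP0 : Set (V → ℚ) := {l | Γ.canonicalPolyCoeff l ≠ 0}

/-- `𝒱^{<0}(ℓ)`, the set of vertices where `ℓ` is negative. -/
def negVertices (_Γ : PlumbingTree V) (l : V → ℚ) : Set V := {v | l v < 0}

open Classical in
/-- `l'` is the associated cycle of `ℓ`: `l' ∈ L'` has the class of `Z_K`, and
`ℓ = Z_K - E - l' - ∑_{v ∈ 𝒱^{<0}(ℓ)} m_v E_v` with non-negative integers `m_v`, where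
`l' ≤ Z_K` and `l'` agrees with `Z_K` on `𝒱^{<0}(ℓ)`. -/
def IsAssociatedCycle (l l' : V → ℚ) : Prop :=
  l' ∈ Γ.L' ∧ l' - Γ.canonicalCycle ∈ Γ.L ∧
  l' ≤ Γ.canonicalCycle ∧
  (∀ v ∈ Γ.negVertices l, (Γ.canonicalCycle - l') v = 0) ∧
  ∃ m : V → ℕ, l = Γ.canonicalCycle - Γ.sumE - l' -
    ∑ v with v ∈ Γ.negVertices l, (m v : ℚ) • Γ.baseE v

/-! ### The Nagy–Némethi elliptic sequence -/

open Classical in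
/-- The least element of a set of cycles (and `0` if there is none). -/
noncomputable def leastCycle (_Γ : PlumbingTree V) (S : Set (V → ℚ)) : V → ℚ :=
  if h : ∃ z, IsLeast S z then h.choose else 0

/-- The part `𝒮'_{[h]}` of class `[h]` of the monoid of anti-nef cycles of `L'`. -/
def lipmanClass (h : V → ℚ) : Set (V → ℚ) :=
  {x | x ∈ Γ.L' ∧ x - h ∈ Γ.L ∧ ∀ v, Γ.form x (Γ.baseE v) ≤ 0}

/-- `s_{[h]} = min 𝒮'_{[h]}`. -/
noncomputable def minRep (h : V → ℚ) : V → ℚ := Γ.leastCycle (Γ.lipmanClass h)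

/-- The minimal (Artin fundamental) cycle of the full subgraph on `B`: the least non-zero effective
integral cycle supported on `B` that is anti-nef on `B`. -/
noncomputable def minCycle (B : Set V) : V → ℚ :=
  Γ.leastCycle {l | l ∈ Γ.L ∧ 0 < l ∧ Γ.supp l ⊆ B ∧ ∀ v ∈ B, Γ.form l (Γ.baseE v) ≤ 0}

/-- `Z_K - s_{[Z_K]} - Z_{B_0} - ⋯ - Z_{B_{k-1}}`, whose support is `B_k`. -/
noncomputable def ellRem : ℕ → V → ℚ
  | 0 => Γ.canonicalCycle - Γ.minRep Γ.canonicalCycle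
  | k + 1 => ellRem k - Γ.minCycle (Γ.supp (ellRem k))

/-- The vertex set of `B_j`, `j ≥ -1`, with `B_{-1} = Γ` and
`B_j = |Z_K - s_{[Z_K]} - Z_{B_0} - ⋯ - Z_{B_{j-1}}|` for `j ≥ 0`. -/
noncomputable def ellB (j : ℤ) : Set V :=
  if j < 0 then Set.univ else Γ.supp (Γ.ellRem j.toNat)

/-- The cycle `Z_{B_j}`, `j ≥ -1`, with `Z_{B_{-1}} = s_{[Z_K]}` and `Z_{B_j}` the minimal cycle of
`B_j` for `j ≥ 0`. -/
noncomputable def ellZ (j : ℤ) : V → ℚ :=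
  if j < 0 then Γ.minRep Γ.canonicalCycle else Γ.minCycle (Γ.ellB j)

/-- The last index `m` of the sequence: the first `k ≥ 0` with
`Z_{B_k} = Z_K - s_{[Z_K]} - Z_{B_0} - ⋯ - Z_{B_{k-1}}`. -/
noncomputable def ellLast : ℕ := sInf {k : ℕ | Γ.ellZ k = Γ.ellRem k}

/-- `C_j = ∑_{i = -1}^{j} Z_{B_i}`. -/
noncomputable def ellC (j : ℤ) : V → ℚ := ∑ i ∈ Finset.Icc (-1) j, Γ.ellZ i

/-- `Supp_j(P_0)`, the set of exponents with associated cycle `C_j`. -/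
def suppP0At (j : ℤ) : Set (V → ℚ) :=
  {l | l ∈ Γ.suppP0 ∧ Γ.IsAssociatedCycle l (Γ.ellC j)}

end PlumbingTree

namespace PlumbingTree

variable {V : Type*} [Fintype V] [DecidableEq V] (Γ : PlumbingTree V)

/-! ### The intersection form -/

/-! Put $x=Z_K-l'$. The defining equation forces $x_v=\ell_v+1$ where $\ell_v\ge0$ and $x_v=0$
elsewhere. This gives existence and uniqueness of $l'$, and shows that $|x|$ is the complement of
$\mathcal V^{<0}(\ell)$.

Exponents of $Z$ are non-negative combinations of the $E^*_v$, and $Z_K$ is anti-nef because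
$e_v\le-2$; together these make $l'$ anti-nef. Since $2\chi(x)=\sum_v x_v(Z_K-x,E_v)$ and
$\chi(x)\ge0$, anti-nefness of $Z_K-x$ forces $(Z_K-x,E_v)=0$ on $|x|$ (`IsElliptic.form_eq_zero`):
$x$ is canonical on its support.

The remainders $r_k=Z_K-C_{k-1}$ (`ellRem`) have the same property. Minimality of $s_{[Z_K]}$ gives
$x\le r_0$. If $x<r_k$, then $r_k-x$ is anti-nef on $B_k$, so it dominates $Z_{B_k}$ and $x\le
r_{k+1}$. As $r_k$ decreases strictly to $0$, $x$ is some $r_k$ (`IsElliptic.exists_eq_ellRem`), and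
it is non-zero because $\ell\not\prec0$.

Connectedness of $B_k$ is not available in advance, so the existence of $Z_{B_k}$ rests on
`IsElliptic.not_disjoint`. -/

theorem intersectionMatrix_symm (v w : V) :
    intersectionMatrix Γ.graph Γ.e v w = intersectionMatrix Γ.graph Γ.e w v := by
  unfold intersectionMatrix
  by_cases h : v = w
  · subst h; rfl
  · by_cases ha : Γ.graph.Adj v w
    · simp [h, Ne.symm h, ha, ha.symm]
    · simp [h, Ne.symm h, ha, mt SimpleGraph.Adj.symm ha]

theorem intersectionMatrix_nonneg {v w : V} (h : v ≠ w) :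
    0 ≤ intersectionMatrix Γ.graph Γ.e v w := by
  unfold intersectionMatrix
  simp only [h, if_false]
  split_ifs <;> norm_num

theorem intersectionMatrix_adj {v w : V} (h : Γ.graph.Adj v w) :
    intersectionMatrix Γ.graph Γ.e v w = 1 := by
  unfold intersectionMatrix
  simp [h.ne, h]

theorem form_baseE_right (x : V → ℚ) (v : V) :
    Γ.form x (Γ.baseE v) = ∑ w, x w * intersectionMatrix Γ.graph Γ.e w v := by
  simp [form, baseE, dotProduct]

theorem form_eq_sum (x y : V → ℚ) : Γ.form x y = ∑ v, y v * Γ.form x (Γ.baseE v) := by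
  simp only [form_baseE_right, Finset.mul_sum]
  rw [Finset.sum_comm]
  simp only [form, dotProduct, Matrix.mulVec, Finset.mul_sum]
  refine Finset.sum_congr rfl fun v _ => Finset.sum_congr rfl fun w _ => by ring

theorem form_comm (x y : V → ℚ) : Γ.form x y = Γ.form y x := by
  rw [form_eq_sum, form_eq_sum Γ y x]
  simp only [form_baseE_right, Finset.mul_sum]
  rw [Finset.sum_comm]
  refine Finset.sum_congr rfl fun v _ => Finset.sum_congr rfl fun w _ => ?_
  rw [Γ.intersectionMatrix_symm v w]; ring

theorem form_add_left (x y z : V → ℚ) : Γ.form (x + y) z = Γ.form x z + Γ.form y z := by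
  simp [form, add_dotProduct]

theorem form_sub_left (x y z : V → ℚ) : Γ.form (x - y) z = Γ.form x z - Γ.form y z := by
  simp [form, sub_dotProduct]

theorem form_add_right (x y z : V → ℚ) : Γ.form x (y + z) = Γ.form x y + Γ.form x z := by
  simp [form, Matrix.mulVec_add]

theorem form_sub_right (x y z : V → ℚ) : Γ.form x (y - z) = Γ.form x y - Γ.form x z := by
  simp [form, Matrix.mulVec_sub]

theorem form_baseE_self (v : V) : Γ.form (Γ.baseE v) (Γ.baseE v) = Γ.e v := by
  rw [form_baseE_right, Finset.sum_eq_single v]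
  · simp [baseE, intersectionMatrix]
  · intro w _ hw
    simp [baseE, hw]
  · simp

theorem mul_intersectionMatrix_nonneg {x : V → ℚ} (hx : 0 ≤ x) {v : V} (hv : x v = 0) (w : V) :
    0 ≤ x w * intersectionMatrix Γ.graph Γ.e w v := by
  by_cases h : w = v
  · simp [h, hv]
  · exact mul_nonneg (hx w) (Γ.intersectionMatrix_nonneg h)

theorem form_baseE_nonneg {x : V → ℚ} (hx : 0 ≤ x) {v : V} (hv : x v = 0) :
    0 ≤ Γ.form x (Γ.baseE v) := by
  rw [form_baseE_right]
  exact Finset.sum_nonneg fun w _ => Γ.mul_intersectionMatrix_nonneg hx hv w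

theorem le_form_baseE_of_adj {x : V → ℚ} (hx : 0 ≤ x) {u v : V} (hv : x v = 0)
    (huv : Γ.graph.Adj u v) : x u ≤ Γ.form x (Γ.baseE v) := by
  rw [form_baseE_right]
  have := Finset.single_le_sum (fun w _ => Γ.mul_intersectionMatrix_nonneg hx hv w)
    (Finset.mem_univ u)
  simpa [Γ.intersectionMatrix_adj huv] using this

theorem form_nonneg_of_disjoint {x y : V → ℚ} (hx : 0 ≤ x) (hy : 0 ≤ y)
    (h : ∀ v, x v = 0 ∨ y v = 0) : 0 ≤ Γ.form x y := by
  rw [form_eq_sum]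
  refine Finset.sum_nonneg fun v _ => ?_
  rcases h v with h | h
  · exact mul_nonneg (hy v) (Γ.form_baseE_nonneg hx h)
  · simp [h]

theorem form_pos_of_adj {x y : V → ℚ} (hx : 0 ≤ x) (hy : 0 ≤ y)
    (h : ∀ v, x v = 0 ∨ y v = 0) {u v : V} (huv : Γ.graph.Adj u v) (hu : x u ≠ 0)
    (hv : y v ≠ 0) : 0 < Γ.form x y := by
  rw [form_eq_sum]
  have hterm : ∀ w ∈ Finset.univ, 0 ≤ y w * Γ.form x (Γ.baseE w) := fun w _ => by
    rcases h w with h | h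
    · exact mul_nonneg (hy w) (Γ.form_baseE_nonneg hx h)
    · simp [h]
  refine Finset.sum_pos' hterm ⟨v, Finset.mem_univ v, ?_⟩
  have hxv : x v = 0 := (h v).resolve_right hv
  exact mul_pos (lt_of_le_of_ne (hy v) hv.symm)
    (lt_of_lt_of_le (lt_of_le_of_ne (hx u) hu.symm) (Γ.le_form_baseE_of_adj hx hxv huv))

/-- The difference `x - x ⊓ y` is effective and vanishes at `v`, so it pairs non-negatively with
$E_v$. -/
theorem form_inf_baseE_le {x y : V → ℚ} {v : V} (h : x v ≤ y v) :
    Γ.form (x ⊓ y) (Γ.baseE v) ≤ Γ.form x (Γ.baseE v) := by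
  have := Γ.form_baseE_nonneg (x := x - x ⊓ y) (sub_nonneg.2 inf_le_left) (v := v) (by simp [h])
  rw [form_sub_left] at this
  linarith

theorem form_inf_baseE_nonpos {x y : V → ℚ} {v : V} (hx : Γ.form x (Γ.baseE v) ≤ 0)
    (hy : Γ.form y (Γ.baseE v) ≤ 0) : Γ.form (x ⊓ y) (Γ.baseE v) ≤ 0 := by
  rcases le_total (x v) (y v) with h | h
  · exact (Γ.form_inf_baseE_le h).trans hx
  · rw [inf_comm]; exact (Γ.form_inf_baseE_le h).trans hy

/-- Anti-nef rational cycles are effective. -/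
theorem nonneg_of_antinef {x : V → ℚ} (hx : ∀ v, Γ.form x (Γ.baseE v) ≤ 0) : 0 ≤ x := by
  by_contra hneg
  have hx' : x⁻ ≠ 0 := fun h => hneg (negPart_eq_zero.1 h)
  -- Pair with the negative part: $(x,x^-)=(x^+,x^-)-(x^-,x^-)$ is positive by negative
  -- definiteness, against anti-nefness.
  have h1 : Γ.form x x⁻ ≤ 0 := by
    rw [form_eq_sum]
    exact Finset.sum_nonpos fun v _ =>
      mul_nonpos_of_nonneg_of_nonpos (negPart_nonneg x v) (hx v)
  have h2 : Γ.form x⁻ x⁻ < 0 := Γ.negDef _ hx'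
  have h3 : 0 ≤ Γ.form x⁺ x⁻ := by
    refine Γ.form_nonneg_of_disjoint (posPart_nonneg x) (negPart_nonneg x) fun v => ?_
    rcases le_total 0 (x v) with h | h
    · right; simpa [Pi.negPart_apply] using h
    · left; simpa [Pi.posPart_apply] using h
  have h4 : Γ.form x x⁻ = Γ.form x⁺ x⁻ - Γ.form x⁻ x⁻ := by
    rw [← form_sub_left, posPart_sub_negPart]
  linarith

/-! ### The lattices -/

theorem mem_L {x : V → ℚ} : x ∈ Γ.L ↔ ∀ v, ∃ n : ℤ, x v = n := by
  constructor
  · rintro ⟨f, rfl⟩ v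
    exact ⟨f v, rfl⟩
  · intro h
    choose f hf using h
    exact ⟨f, funext fun v => (hf v).symm⟩

theorem inf_mem_L {x y : V → ℚ} (hx : x ∈ Γ.L) (hy : y ∈ Γ.L) : x ⊓ y ∈ Γ.L := by
  rw [mem_L] at *
  intro v
  rcases le_total (x v) (y v) with h | h
  · simpa [h] using hx v
  · simpa [h] using hy v

theorem baseE_mem_L (v : V) : Γ.baseE v ∈ Γ.L := by
  rw [mem_L]
  intro w
  by_cases h : w = v
  · subst h; exact ⟨1, by simp [baseE]⟩
  · exact ⟨0, by simp [baseE, h]⟩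

theorem sumE_apply (v : V) : Γ.sumE v = 1 := by
  simp [sumE, baseE, Finset.sum_apply, Pi.single_apply]

theorem sumE_mem_L : Γ.sumE ∈ Γ.L :=
  Γ.L.sum_mem fun v _ => Γ.baseE_mem_L v

theorem one_le_of_mem_L {x : V → ℚ} (hx : x ∈ Γ.L) {v : V} (hv : 0 < x v) : 1 ≤ x v := by
  obtain ⟨n, hn⟩ := Γ.mem_L.1 hx v
  rw [hn] at hv ⊢
  exact_mod_cast hv

theorem mem_L'_of_antidual {x : V → ℚ} (h : ∀ v, ∃ n : ℤ, Γ.form x (Γ.baseE v) = n) :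
    x ∈ Γ.L' := by
  intro y hy
  choose f hf using h
  choose g hg using Γ.mem_L.1 hy
  refine ⟨∑ v, g v * f v, ?_⟩
  rw [form_eq_sum]
  push_cast
  exact Finset.sum_congr rfl fun v _ => by rw [hf, hg]

theorem L_le_L' : Γ.L ≤ Γ.L' := by
  classical
  intro x hx
  refine Γ.mem_L'_of_antidual fun v => ?_
  choose g hg using Γ.mem_L.1 hx
  refine ⟨∑ w, g w * (if w = v then Γ.e w else if Γ.graph.Adj w v then 1 else 0), ?_⟩
  · rw [form_baseE_right]
    push_cast
    refine Finset.sum_congr rfl fun w _ => ?_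
    rw [hg, intersectionMatrix]

theorem canonicalCycle_mem_L' : Γ.canonicalCycle ∈ Γ.L' :=
  Γ.mem_L'_of_antidual fun v => ⟨Γ.e v + 2, by rw [form_canonicalCycle]; push_cast; rfl⟩

theorem mem_L'_of_sub_canonicalCycle_mem_L {x : V → ℚ} (h : x - Γ.canonicalCycle ∈ Γ.L) :
    x ∈ Γ.L' := by
  simpa using Γ.L'.add_mem (Γ.L_le_L' h) Γ.canonicalCycle_mem_L'

/-! ### Least cycles -/

/-- An element with minimal coordinate sum is least, since its meet with any other element stays in
`S` and cannot have a smaller sum. Shifting by `h` makes the sums integers, and effectivity bounds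
them below. -/
theorem exists_isLeast {S : Set (V → ℚ)} (h : V → ℚ) (hne : S.Nonempty)
    (hinf : ∀ x ∈ S, ∀ y ∈ S, x ⊓ y ∈ S) (hint : ∀ x ∈ S, x - h ∈ Γ.L)
    (hpos : ∀ x ∈ S, 0 ≤ x) : ∃ z, IsLeast S z := by
  have hsum : ∀ x ∈ S, ∃ n : ℤ, ∑ v, (x v - h v) = n := fun x hx => by
    choose f hf using Γ.mem_L.1 (hint x hx)
    refine ⟨∑ v, f v, ?_⟩
    push_cast
    exact Finset.sum_congr rfl fun v _ => hf v
  obtain ⟨n, ⟨z, hz, hzn⟩, hmin⟩ := Int.exists_least_of_bdd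
    (P := fun n : ℤ => ∃ x ∈ S, ∑ v, (x v - h v) = n)
    ⟨⌊∑ v, -h v⌋, by
      rintro n ⟨x, hx, hxn⟩
      have : (⌊∑ v, -h v⌋ : ℚ) ≤ n := by
        refine (Int.floor_le _).trans ?_
        rw [← hxn]
        exact Finset.sum_le_sum fun v _ => by linarith [show 0 ≤ x v from hpos x hx v]
      exact_mod_cast this⟩
    (by
      obtain ⟨x, hx⟩ := hne
      obtain ⟨n, hn⟩ := hsum x hx
      exact ⟨n, x, hx, hn⟩)
  refine ⟨z, hz, fun y hy v => ?_⟩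
  obtain ⟨k, hk⟩ := hsum _ (hinf z hz y hy)
  have hle : (n : ℚ) ≤ k := by exact_mod_cast hmin k ⟨_, hinf z hz y hy, hk⟩
  by_contra hlt
  rw [not_le] at hlt
  have : ∑ w, ((z ⊓ y) w - h w) < ∑ w, (z w - h w) := by
    refine Finset.sum_lt_sum (fun w _ => ?_) ⟨v, Finset.mem_univ v, ?_⟩
    · have : (z ⊓ y) w ≤ z w := inf_le_left
      linarith
    · have : (z ⊓ y) v = y v := by simp [hlt.le]
      linarith
  linarith

theorem isLeast_leastCycle {S : Set (V → ℚ)} (h : ∃ z, IsLeast S z) :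
    IsLeast S (Γ.leastCycle S) := by
  unfold leastCycle
  rw [dif_pos h]
  exact h.choose_spec

/-! ### The Riemann–Roch function -/

theorem chi_add (x y : V → ℚ) : Γ.chi (x + y) = Γ.chi x + Γ.chi y - Γ.form x y := by
  simp only [chi, form_add_left, form_sub_right, form_add_right]
  rw [Γ.form_comm y x]
  ring

theorem chi_baseE (v : V) : Γ.chi (Γ.baseE v) = 1 := by
  rw [chi, form_sub_right, form_baseE_self, form_comm, form_canonicalCycle]
  ring

/-- In this form the sign of $\chi$ can be read off term by term. -/
theorem chi_eq_sum (x : V → ℚ) :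
    Γ.chi x = (∑ v, x v * Γ.form (Γ.canonicalCycle - x) (Γ.baseE v)) / 2 := by
  rw [← form_eq_sum, chi, form_comm, form_sub_left, form_sub_left]
  ring

theorem chi_eq_zero_of_adjunction {x : V → ℚ}
    (h : ∀ v ∈ Γ.supp x, Γ.form (Γ.canonicalCycle - x) (Γ.baseE v) = 0) : Γ.chi x = 0 := by
  rw [chi_eq_sum, Finset.sum_eq_zero, zero_div]
  intro v _
  by_cases hv : x v = 0
  · simp [hv]
  · rw [h v hv, mul_zero]

variable {Γ}

theorem IsElliptic.chi_nonneg (hΓ : Γ.IsElliptic) {x : V → ℚ} (hx : x ∈ Γ.L) (h0 : 0 ≤ x) :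
    0 ≤ Γ.chi x := by
  rcases h0.eq_or_lt with h | h
  · simp [← h, chi, form]
  · exact hΓ.1.2 ⟨x, ⟨hx, h⟩, rfl⟩

theorem IsElliptic.form_canonicalCycle_nonpos (hΓ : Γ.IsElliptic) (v : V) :
    Γ.form Γ.canonicalCycle (Γ.baseE v) ≤ 0 := by
  rw [form_canonicalCycle]
  have : (Γ.e v : ℚ) ≤ -2 := by exact_mod_cast hΓ.2 v
  linarith

/-- If `Z_K - x` is anti-nef along the support of the effective cycle `x`, then `x` is the
canonical cycle of its support. -/
theorem IsElliptic.form_eq_zero (hΓ : Γ.IsElliptic) {x : V → ℚ} (hx : x ∈ Γ.L) (h0 : 0 ≤ x)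
    (h : ∀ v ∈ Γ.supp x, Γ.form (Γ.canonicalCycle - x) (Γ.baseE v) ≤ 0) :
    ∀ v ∈ Γ.supp x, Γ.form (Γ.canonicalCycle - x) (Γ.baseE v) = 0 := by
  have hterm : ∀ v ∈ Finset.univ, x v * Γ.form (Γ.canonicalCycle - x) (Γ.baseE v) ≤ 0 := by
    intro v _
    by_cases hv : x v = 0
    · simp [hv]
    · exact mul_nonpos_of_nonneg_of_nonpos (h0 v) (h v hv)
  have hsum := Finset.sum_nonpos hterm
  have hchi := hΓ.chi_nonneg hx h0
  rw [chi_eq_sum] at hchi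
  -- The sum has non-positive terms but is non-negative by ellipticity, so every term vanishes.
  have hzero := (Finset.sum_eq_zero_iff_of_nonpos hterm).1 (by linarith)
  intro v hv
  exact (mul_eq_zero.1 (hzero v (Finset.mem_univ v))).resolve_left hv

/-- In an elliptic graph, two non-zero effective cycles with `χ = 0` have a common component. -/
theorem IsElliptic.not_disjoint (hΓ : Γ.IsElliptic) {x y : V → ℚ} (hx : x ∈ Γ.L) (hy : y ∈ Γ.L)
    (hx0 : 0 < x) (hy0 : 0 < y) (hχx : Γ.chi x = 0) (hχy : Γ.chi y = 0) :
    ∃ v, x v ≠ 0 ∧ y v ≠ 0 := by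
  by_contra! hdisj
  -- Among the cycles with $\chi=0$ disjoint from `y`, take `z` of maximal support; a path from
  -- $|z|$ to $|y|$ then leaves $|z|$ along some edge.
  obtain ⟨s, ⟨z, ⟨hz, hz0, hχz, hzy⟩, rfl⟩, hmax⟩ := (Set.toFinite
    (Γ.supp '' {z | z ∈ Γ.L ∧ 0 < z ∧ Γ.chi z = 0 ∧ ∀ v, z v ≠ 0 → y v = 0})).exists_maximal
    ⟨_, x, ⟨hx, hx0, hχx, hdisj⟩, rfl⟩
  obtain ⟨u, hu⟩ : ∃ u, z u ≠ 0 := Function.ne_iff.1 hz0.ne'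
  obtain ⟨w, hw⟩ : ∃ w, y w ≠ 0 := Function.ne_iff.1 hy0.ne'
  have hwz : w ∉ Γ.supp z := fun h => hw (hzy w h)
  obtain ⟨p⟩ := Γ.isTree.connected.preconnected u w
  obtain ⟨d, -, hd1, hd2⟩ := p.exists_boundary_dart (Γ.supp z) hu hwz
  have hd2' : z d.snd = 0 := not_not.1 hd2
  by_cases hv : y d.snd = 0
  -- The edge ends outside $|y|$: $\chi(z+E_v)=1-(z,E_v)\le0$, so adding $E_v$ keeps $\chi=0$ and
  -- enlarges the support.
  · have h1 : (1 : ℚ) ≤ Γ.form z (Γ.baseE d.snd) :=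
      (Γ.one_le_of_mem_L hz (lt_of_le_of_ne (hz0.le _) (Ne.symm hd1))).trans
        (Γ.le_form_baseE_of_adj hz0.le hd2' d.adj)
    have hE : (0 : V → ℚ) ≤ Γ.baseE d.snd := by simp [baseE]
    have hmem := Γ.L.add_mem hz (Γ.baseE_mem_L d.snd)
    have hχ := hΓ.chi_nonneg hmem (add_nonneg hz0.le hE)
    rw [chi_add, chi_baseE, hχz] at hχ
    have hsub := hmax ⟨z + Γ.baseE d.snd, ⟨hmem, add_pos_of_pos_of_nonneg hz0 hE, by
      rw [chi_add, chi_baseE, hχz]; linarith, fun v hne => by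
        by_cases hvd : v = d.snd
        · rwa [hvd]
        · exact hzy v (by simpa [baseE, hvd] using hne)⟩, rfl⟩
      (fun v (hne : z v ≠ 0) => by
        change z v + Γ.baseE d.snd v ≠ 0
        have h2 : 0 < z v := lt_of_le_of_ne (hz0.le v) hne.symm
        have h3 : 0 ≤ Γ.baseE d.snd v := hE v
        exact (by linarith : 0 < z v + Γ.baseE d.snd v).ne')
    refine hd2 (hsub ?_)
    change z d.snd + Γ.baseE d.snd d.snd ≠ 0
    simp [hd2', baseE]
  -- The edge ends in $|y|$: $\chi(z+y)=-(z,y)<0$ contradicts ellipticity.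
  · have hpos : 0 < Γ.form z y := Γ.form_pos_of_adj hz0.le hy0.le
      (fun v => or_iff_not_imp_left.2 (hzy v)) d.adj hd1 hv
    have hχ := hΓ.chi_nonneg (Γ.L.add_mem hz hy) (add_nonneg hz0.le hy0.le)
    rw [chi_add, hχz, hχy] at hχ
    linarith

/-! ### Existence of the minimal cycles of the elliptic sequence -/

theorem IsElliptic.isLeast_minRep (hΓ : Γ.IsElliptic) :
    IsLeast (Γ.lipmanClass Γ.canonicalCycle) (Γ.minRep Γ.canonicalCycle) := by
  refine Γ.isLeast_leastCycle (Γ.exists_isLeast Γ.canonicalCycle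
    ⟨Γ.canonicalCycle, Γ.canonicalCycle_mem_L', by simp, hΓ.form_canonicalCycle_nonpos⟩
    ?_ (fun x hx => hx.2.1) (fun x hx => Γ.nonneg_of_antinef hx.2.2))
  intro x hx y hy
  have hmem : x ⊓ y - Γ.canonicalCycle ∈ Γ.L := by
    rw [inf_sub]
    exact Γ.inf_mem_L hx.2.1 hy.2.1
  exact ⟨Γ.mem_L'_of_sub_canonicalCycle_mem_L hmem, hmem,
    fun v => Γ.form_inf_baseE_nonpos (hx.2.2 v) (hy.2.2 v)⟩

variable (Γ) in
/-- `x` is effective, integral, and is the canonical cycle of its support. -/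
def IsSupportCanonical (x : V → ℚ) : Prop :=
  x ∈ Γ.L ∧ 0 ≤ x ∧ ∀ v ∈ Γ.supp x, Γ.form (Γ.canonicalCycle - x) (Γ.baseE v) = 0

/-- The part of `x` over the support of `l` is again canonical on its support, when `l` is anti-nef
along the support of `x`. -/
theorem IsSupportCanonical.restrict {x l : V → ℚ} (hx : Γ.IsSupportCanonical x) (hl0 : 0 < l)
    (hls : Γ.supp l ⊆ Γ.supp x) (hl : ∀ v ∈ Γ.supp x, Γ.form l (Γ.baseE v) ≤ 0) :
    ∃ y ∈ Γ.L, 0 < y ∧ Γ.chi y = 0 ∧ ∀ v, y v ≠ 0 → l v ≠ 0 := by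
  classical
  obtain ⟨hxL, hx0, hxK⟩ := hx
  let y : V → ℚ := fun v => if l v = 0 then 0 else x v
  have hy : ∀ v, y v ≠ 0 → l v ≠ 0 := fun v h => by
    by_contra h0
    exact h (by simp [y, h0])
  have hyx : ∀ v, l v ≠ 0 → y v = x v := fun v h => by simp [y, h]
  have hy0 : 0 ≤ y := fun v => by
    by_cases h : l v = 0
    · simp [y, h]
    · simpa [y, h] using hx0 v
  -- Such an edge would make $(l,E_w)>0$. Hence $|l|$ is a union of components of $|x|$, and
  -- truncating `x` to it leaves the pairings along $|l|$ unchanged.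
  have hadj : ∀ v w, l v ≠ 0 → l w = 0 → x w ≠ 0 → ¬ Γ.graph.Adj v w := by
    intro v w hv hw hxw hvw
    have h1 := Γ.le_form_baseE_of_adj hl0.le hw hvw
    have h2 := hl w hxw
    exact hv (le_antisymm (h1.trans h2) (hl0.le v))
  refine ⟨y, ?_, ?_, ?_, hy⟩
  · rw [mem_L] at hxL ⊢
    intro v
    by_cases h : l v = 0
    · exact ⟨0, by simp [y, h]⟩
    · rw [hyx v h]; exact hxL v
  · refine lt_of_le_of_ne hy0 fun h => ?_
    obtain ⟨v, hv⟩ : ∃ v, l v ≠ 0 := Function.ne_iff.1 hl0.ne'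
    exact hls hv (by rw [← hyx v hv, ← h]; rfl)
  · refine Γ.chi_eq_zero_of_adjunction fun v hv => ?_
    have hlv := hy v hv
    rw [← hxK v (hls hlv), form_sub_left, form_sub_left, form_baseE_right Γ y,
      form_baseE_right Γ x]
    congr 1
    refine Finset.sum_congr rfl fun w _ => ?_
    by_cases hw : l w = 0
    · by_cases hxw : x w = 0
      · simp [y, hw, hxw]
      · have hne : w ≠ v := fun h => hlv (h ▸ hw)
        have hna : ¬ Γ.graph.Adj w v := fun h => hadj v w hlv hw hxw h.symm
        simp [intersectionMatrix, hne, hna]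
    · rw [hyx w hw]

variable (Γ) in
/-- The cycles whose least element is the minimal cycle of the full subgraph on `B`. -/
def antinefOn (B : Set V) : Set (V → ℚ) :=
  {l | l ∈ Γ.L ∧ 0 < l ∧ Γ.supp l ⊆ B ∧ ∀ v ∈ B, Γ.form l (Γ.baseE v) ≤ 0}

theorem IsSupportCanonical.mem_antinefOn (hΓ : Γ.IsElliptic) {x : V → ℚ}
    (hx : Γ.IsSupportCanonical x) (hne : x ≠ 0) : x ∈ Γ.antinefOn (Γ.supp x) := by
  refine ⟨hx.1, lt_of_le_of_ne hx.2.1 hne.symm, subset_rfl, fun v hv => ?_⟩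
  have h1 := hx.2.2 v hv
  have h2 := hΓ.form_canonicalCycle_nonpos v
  rw [form_sub_left] at h1
  linarith

/-- The danger is that two anti-nef cycles on $|x|$ have meet zero. By `restrict` their supports
each carry a cycle with $\chi=0$, and two such cycles cannot be disjoint. -/
theorem IsSupportCanonical.isLeast_minCycle (hΓ : Γ.IsElliptic) {x : V → ℚ}
    (hx : Γ.IsSupportCanonical x) (hne : x ≠ 0) :
    IsLeast (Γ.antinefOn (Γ.supp x)) (Γ.minCycle (Γ.supp x)) := by
  refine Γ.isLeast_leastCycle (Γ.exists_isLeast 0 ⟨x, hx.mem_antinefOn hΓ hne⟩ ?_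
    (fun l hl => by simpa using hl.1) (fun l hl => hl.2.1.le))
  rintro a ⟨haL, ha0, has, ha⟩ b ⟨hbL, hb0, hbs, hb⟩
  have hinf0 : 0 ≤ a ⊓ b := le_inf ha0.le hb0.le
  have hpos : ∀ v, a v ≠ 0 → b v ≠ 0 → (a ⊓ b) v ≠ 0 := fun v h1 h2 => by
    rcases le_total (a v) (b v) with h | h
    · simpa [h] using h1
    · simpa [h] using h2
  refine ⟨Γ.inf_mem_L haL hbL, lt_of_le_of_ne hinf0 fun h => ?_, fun v hv => ?_,
    fun v hv => Γ.form_inf_baseE_nonpos (ha v hv) (hb v hv)⟩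
  · obtain ⟨y, hyL, hy0, hχy, hya⟩ := hx.restrict ha0 has ha
    obtain ⟨z, hzL, hz0, hχz, hzb⟩ := hx.restrict hb0 hbs hb
    obtain ⟨v, hv1, hv2⟩ := hΓ.not_disjoint hyL hzL hy0 hz0 hχy hχz
    exact hpos v (hya v hv1) (hzb v hv2) (by rw [← h]; rfl)
  · refine has fun hav => hv ?_
    exact le_antisymm (le_trans inf_le_left hav.le) (hinf0 v)

variable (Γ) in
theorem minCycle_nonneg (B : Set V) : 0 ≤ Γ.minCycle B := by
  unfold minCycle leastCycle
  split_ifs with h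
  · exact h.choose_spec.1.2.1.le
  · exact le_rfl

variable (Γ) in
-- No non-zero cycle lives on the empty set, so the default value applies; the remainders stay at
-- $0$ once they reach it.
theorem minCycle_supp_zero : Γ.minCycle (Γ.supp 0) = 0 := by
  unfold minCycle leastCycle
  rw [dif_neg]
  rintro ⟨z, ⟨-, hz0, hzs, -⟩, -⟩
  refine hz0.ne' (funext fun v => ?_)
  by_contra hv
  exact hzs hv rfl

/-! ### The elliptic sequence -/

variable (Γ) in
theorem ellRem_antitone : Antitone Γ.ellRem :=
  antitone_nat_of_succ_le fun k => by
    change Γ.ellRem k - Γ.minCycle _ ≤ Γ.ellRem k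
    exact sub_le_self _ (Γ.minCycle_nonneg _)

/-- On $|r_{k+1}|\subseteq B_k$ one has $(Z_K-r_{k+1},E_v)=(Z_{B_k},E_v)\le0$, which `form_eq_zero`
upgrades to equality. For $r_0$ the role of $Z_{B_k}$ is played by $s_{[Z_K]}$. -/
theorem IsElliptic.isSupportCanonical_ellRem (hΓ : Γ.IsElliptic) (k : ℕ) :
    Γ.IsSupportCanonical (Γ.ellRem k) := by
  induction k with
  | zero =>
    obtain ⟨⟨-, hsL, hs⟩, hmin⟩ := hΓ.isLeast_minRep
    have hL : Γ.ellRem 0 ∈ Γ.L := by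
      have := Γ.L.neg_mem hsL
      rwa [neg_sub] at this
    have h0 : 0 ≤ Γ.ellRem 0 := sub_nonneg.2 (hmin
      ⟨Γ.canonicalCycle_mem_L', by simp, hΓ.form_canonicalCycle_nonpos⟩)
    refine ⟨hL, h0, hΓ.form_eq_zero hL h0 fun v _ => ?_⟩
    rw [ellRem, sub_sub_cancel]
    exact hs v
  | succ k ih =>
    by_cases hne : Γ.ellRem k = 0
    · rw [ellRem, hne, minCycle_supp_zero, sub_zero, ← hne]
      exact ih
    · obtain ⟨⟨hzL, -, hzs, hz⟩, hmin⟩ := ih.isLeast_minCycle hΓ hne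
      have hL : Γ.ellRem (k + 1) ∈ Γ.L := Γ.L.sub_mem ih.1 hzL
      have h0 : 0 ≤ Γ.ellRem (k + 1) := sub_nonneg.2 (hmin (ih.mem_antinefOn hΓ hne))
      refine ⟨hL, h0, hΓ.form_eq_zero hL h0 fun v hv => ?_⟩
      have hvk : v ∈ Γ.supp (Γ.ellRem k) := fun h =>
        hv (le_antisymm (h ▸ Γ.ellRem_antitone k.le_succ v) (h0 v))
      have h1 := ih.2.2 v hvk
      have h2 := hz v hvk
      rw [form_sub_left] at h1
      rw [ellRem, form_sub_left, form_sub_left]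
      linarith

theorem IsElliptic.ellRem_succ_lt (hΓ : Γ.IsElliptic) {k : ℕ} (hne : Γ.ellRem k ≠ 0) :
    Γ.ellRem (k + 1) < Γ.ellRem k :=
  sub_lt_self _ ((hΓ.isSupportCanonical_ellRem k).isLeast_minCycle hΓ hne).1.2.1

theorem IsElliptic.exists_ellRem_eq_zero (hΓ : Γ.IsElliptic) : ∃ k, Γ.ellRem k = 0 := by
  by_contra! hne
  have hsum : ∀ k, ∃ n : ℕ, ∑ v, Γ.ellRem k v = n := fun k => by
    obtain ⟨hL, h0, -⟩ := hΓ.isSupportCanonical_ellRem k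
    have : ∀ v, ∃ n : ℕ, Γ.ellRem k v = n := fun v => by
      obtain ⟨n, hn⟩ := Γ.mem_L.1 hL v
      have hn0 : 0 ≤ n := by
        have : 0 ≤ Γ.ellRem k v := h0 v
        rw [hn] at this
        exact_mod_cast this
      lift n to ℕ using hn0
      exact ⟨n, by simpa using hn⟩
    choose f hf using this
    exact ⟨∑ v, f v, by push_cast; exact Finset.sum_congr rfl fun v _ => hf v⟩
  choose f hf using hsum
  have hanti : StrictAnti f := strictAnti_nat_of_succ_lt fun k => by
    have hlt := hΓ.ellRem_succ_lt (hne k)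
    obtain ⟨hle, v, hv⟩ := Pi.lt_def.1 hlt
    have : (f (k + 1) : ℚ) < f k := by
      rw [← hf, ← hf]
      exact Finset.sum_lt_sum (fun w _ => hle w) ⟨v, Finset.mem_univ v, hv⟩
    exact_mod_cast this
  exact not_strictAnti_of_wellFoundedLT f hanti

variable (Γ) in
theorem ellB_natCast (k : ℕ) : Γ.ellB k = Γ.supp (Γ.ellRem k) := by
  simp [ellB]

variable (Γ) in
theorem ellZ_natCast (k : ℕ) : Γ.ellZ k = Γ.minCycle (Γ.supp (Γ.ellRem k)) := by
  rw [← ellB_natCast]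
  simp [ellZ]

theorem IsElliptic.ellRem_ellLast_succ (hΓ : Γ.IsElliptic) :
    Γ.ellRem (Γ.ellLast + 1) = 0 := by
  obtain ⟨k, hk⟩ := hΓ.exists_ellRem_eq_zero
  -- The infimum is attained because the set is non-empty: both sides are zero once the remainder
  -- is.
  have hmem : Γ.ellLast ∈ {k : ℕ | Γ.ellZ k = Γ.ellRem k} :=
    Nat.sInf_mem ⟨k, by rw [Set.mem_ofPred_eq, ellZ_natCast, hk, minCycle_supp_zero]⟩
  rw [Set.mem_ofPred_eq, ellZ_natCast] at hmem
  rw [ellRem, hmem, sub_self]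

theorem IsElliptic.le_ellLast (hΓ : Γ.IsElliptic) {k : ℕ} (hne : Γ.ellRem k ≠ 0) :
    k ≤ Γ.ellLast := by
  by_contra! hlt
  refine hne (le_antisymm ?_ (hΓ.isSupportCanonical_ellRem k).2.1)
  rw [← hΓ.ellRem_ellLast_succ]
  exact Γ.ellRem_antitone hlt

theorem IsElliptic.ellRem_injective (hΓ : Γ.IsElliptic) {j k : ℕ} (hne : Γ.ellRem j ≠ 0)
    (h : Γ.ellRem j = Γ.ellRem k) : j = k := by
  have key : ∀ {a b : ℕ}, Γ.ellRem a ≠ 0 → a < b → Γ.ellRem b ≠ Γ.ellRem a := fun ha hab =>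
    ((Γ.ellRem_antitone hab).trans_lt (hΓ.ellRem_succ_lt ha)).ne
  rcases lt_trichotomy j k with hlt | heq | hlt
  · exact absurd h.symm (key hne hlt)
  · exact heq
  · exact absurd h (key (h ▸ hne) hlt)

variable (Γ) in
theorem ellC_eq (k : ℕ) : Γ.ellC ((k : ℤ) - 1) = Γ.canonicalCycle - Γ.ellRem k := by
  induction k with
  | zero => simp [ellC, ellZ, ellRem]
  | succ k ih =>
    have hIcc : Finset.Icc (-1 : ℤ) (((k + 1 : ℕ) : ℤ) - 1)
        = insert (k : ℤ) (Finset.Icc (-1 : ℤ) ((k : ℤ) - 1)) := by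
      ext i
      simp only [Finset.mem_Icc, Finset.mem_insert]
      omega
    rw [ellC, hIcc, Finset.sum_insert (by simp), ← ellC, ih, ellZ_natCast, ellRem]
    abel

/-- An effective cycle that is canonical on its support and lies below the first member of the
sequence `Z_K - C_j` is one of its members. -/
theorem IsElliptic.exists_eq_ellRem (hΓ : Γ.IsElliptic) {x : V → ℚ}
    (hx : Γ.IsSupportCanonical x) (hle : x ≤ Γ.ellRem 0) : ∃ k, x = Γ.ellRem k := by
  by_contra! hne
  have hall : ∀ k, x ≤ Γ.ellRem k := by
    intro k
    induction k with
    | zero => exact hle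
    | succ k ih =>
      have hr := hΓ.isSupportCanonical_ellRem k
      have hlt : x < Γ.ellRem k := lt_of_le_of_ne ih (hne k)
      have hr0 : Γ.ellRem k ≠ 0 := (hx.2.1.trans_lt hlt).ne'
      -- The cycle $r_k-x$ is anti-nef on $B_k$: its pairing with $E_v$ is zero where $x_v\ne0$, and
      -- is $(Z_K,E_v)-(x,E_v)\le0$ where $x_v=0$.
      refine le_sub_comm.1 ((hr.isLeast_minCycle hΓ hr0).2
        ⟨Γ.L.sub_mem hr.1 hx.1, sub_pos.2 hlt, fun v hv h => ?_, fun v hv => ?_⟩)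
      · have h1 : x v ≤ Γ.ellRem k v := ih v
        have h2 : 0 ≤ x v := hx.2.1 v
        exact hv (by rw [Pi.sub_apply]; linarith)
      · have h1 := hr.2.2 v hv
        rw [form_sub_left] at h1 ⊢
        by_cases hxv : x v = 0
        · have h2 := Γ.form_baseE_nonneg hx.2.1 hxv
          have h3 := hΓ.form_canonicalCycle_nonpos v
          linarith
        · have h2 := hx.2.2 v hxv
          rw [form_sub_left] at h2
          linarith
  obtain ⟨k, hk⟩ := hΓ.exists_ellRem_eq_zero
  exact hne k (le_antisymm (hall k) (hk ▸ hx.2.1))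

/-! ### Exponents of the canonical polynomial -/

theorem exists_nonneg_of_mem_suppP0 {l : V → ℚ} (hl : l ∈ Γ.suppP0) : ∃ v, 0 ≤ l v := by
  by_contra! h
  exact hl (by rw [canonicalPolyCoeff, if_pos h])

theorem dualCoeff_ne_zero {l : V → ℚ} (hl : l ∈ Γ.suppP0) : Γ.dualCoeff l ≠ 0 := by
  intro h
  refine hl ?_
  rw [canonicalPolyCoeff, h, ite_self]

theorem mem_L_of_mem_suppP0 {l : V → ℚ} (hl : l ∈ Γ.suppP0) : l ∈ Γ.L := by
  have h := dualCoeff_ne_zero hl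
  rw [dualCoeff, poincareCoeffClass] at h
  split_ifs at h with hL
  · have := Γ.L.neg_mem (Γ.L.add_mem hL Γ.sumE_mem_L)
    convert this using 1
    abel
  · exact absurd rfl h

/-- A non-zero coefficient comes from an exponent $\sum_w a_wE^*_w$ with $a_w\ge0$, whose pairing
with $E_v$ is $-a_v$. -/
theorem antinef_of_mem_suppP0 {l : V → ℚ} (hl : l ∈ Γ.suppP0) (v : V) :
    Γ.form (Γ.canonicalCycle - Γ.sumE - l) (Γ.baseE v) ≤ 0 := by
  have h := dualCoeff_ne_zero hl
  rw [dualCoeff, poincareCoeffClass] at h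
  split_ifs at h with hL
  · obtain ⟨a, ha, -⟩ := exists_ne_zero_of_finsum_mem_ne_zero h
    rw [← show _ = _ from ha]
    have hE : ∀ w, Γ.dualE w ⬝ᵥ (intersectionMatrix Γ.graph Γ.e *ᵥ Γ.baseE v)
        = if w = v then -1 else 0 := fun w => Γ.form_dualE w v
    simp [form, sum_dotProduct, hE]
  · exact absurd rfl h

theorem IsAssociatedCycle.sub_apply_of_nonneg {l l' : V → ℚ} (h : Γ.IsAssociatedCycle l l')
    {v : V} (hv : 0 ≤ l v) : (Γ.canonicalCycle - l') v = l v + 1 := by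
  classical
  obtain ⟨-, -, -, -, m, hm⟩ := h
  have := congrFun hm v
  have hs : (∑ w with w ∈ Γ.negVertices l, (m w : ℚ) • Γ.baseE w) v = 0 := by
    rw [Finset.sum_apply]
    refine Finset.sum_eq_zero fun w hw => ?_
    have hwv : v ≠ w := by
      rintro rfl
      exact absurd (Finset.mem_filter.1 hw).2 (not_lt.2 hv)
    simp [baseE, hwv]
  simp only [Pi.sub_apply] at this ⊢
  rw [hs, sumE_apply] at this
  linarith

theorem IsAssociatedCycle.unique {l a b : V → ℚ} (ha : Γ.IsAssociatedCycle l a)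
    (hb : Γ.IsAssociatedCycle l b) : a = b := by
  refine sub_right_injective (b := Γ.canonicalCycle) (funext fun v => ?_)
  change (Γ.canonicalCycle - a) v = (Γ.canonicalCycle - b) v
  by_cases hv : l v < 0
  · rw [ha.2.2.2.1 v hv, hb.2.2.2.1 v hv]
  · rw [ha.sub_apply_of_nonneg (not_lt.1 hv), hb.sub_apply_of_nonneg (not_lt.1 hv)]

theorem exists_isAssociatedCycle {l : V → ℚ} (hl : l ∈ Γ.L) :
    ∃ l', Γ.IsAssociatedCycle l l' := by
  classical
  choose f hf using Γ.mem_L.1 hl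
  -- This is the only possible value of $Z_K-l'$.
  let x : V → ℚ := fun v => if l v < 0 then 0 else l v + 1
  have hxL : x ∈ Γ.L := Γ.mem_L.2 fun v => by
    by_cases h : l v < 0
    · exact ⟨0, by simp [x, h]⟩
    · exact ⟨f v + 1, by simp only [x, h, if_false]; rw [hf]; push_cast; rfl⟩
  have hx0 : 0 ≤ x := fun v => by
    by_cases h : l v < 0
    · simp [x, h]
    · simp only [x, h, if_false, Pi.zero_apply]; linarith
  have hclass : Γ.canonicalCycle - x - Γ.canonicalCycle ∈ Γ.L := by
    simpa using hxL
  -- Where $\ell_v<0$ the equation forces $m_v=-1-\ell_v$, which is non-negative by integrality; the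
  -- truncated values elsewhere do not enter the sum.
  refine ⟨Γ.canonicalCycle - x, Γ.mem_L'_of_sub_canonicalCycle_mem_L hclass, hclass,
    sub_le_self _ hx0, fun v hv => ?_, fun v => (-1 - f v).toNat, funext fun v => ?_⟩
  · rw [sub_sub_cancel]
    exact if_pos hv
  · have hs : (∑ w with w ∈ Γ.negVertices l, (((-1 - f w).toNat : ℕ) : ℚ) • Γ.baseE w) v
        = if l v < 0 then (((-1 - f v).toNat : ℕ) : ℚ) else 0 := by
      rw [Finset.sum_filter, Finset.sum_apply, Finset.sum_eq_single v]
      · by_cases h : l v < 0 <;> simp [negVertices, baseE, h]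
      · intro w _ hw
        by_cases h : w ∈ Γ.negVertices l <;> simp [baseE, h, hw.symm]
      · simp
    simp only [Pi.sub_apply]
    rw [hs, sumE_apply]
    by_cases h : l v < 0
    · have hfv : f v < 0 := by rw [hf] at h; exact_mod_cast h
      have hcast : (((-1 - f v).toNat : ℕ) : ℚ) = -1 - l v := by
        rw [hf v, ← Int.cast_natCast, Int.toNat_of_nonneg (by omega)]
        push_cast; rfl
      simp only [x, h, if_true]
      rw [hcast]; ring
    · simp only [x, h, if_false]; ring

theorem IsAssociatedCycle.negVertices_eq {l l' : V → ℚ} (h : Γ.IsAssociatedCycle l l') :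
    Γ.negVertices l = Set.univ \ Γ.supp (Γ.canonicalCycle - l') := by
  ext v
  simp only [Set.mem_sdiff, Set.mem_univ, true_and]
  constructor
  · exact fun hv hs => hs (h.2.2.2.1 v hv)
  · intro hv
    by_contra hneg
    have hl : 0 ≤ l v := not_lt.1 hneg
    refine hv ?_
    change (Γ.canonicalCycle - l') v ≠ 0
    rw [h.sub_apply_of_nonneg hl]
    linarith

/-- Here the exclusion of $\ell\prec0$ from $P_0$ is used; it rules out $l'=Z_K=C_m$. -/
theorem IsAssociatedCycle.sub_ne_zero {l l' : V → ℚ} (h : Γ.IsAssociatedCycle l l')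
    (hl : l ∈ Γ.suppP0) : Γ.canonicalCycle - l' ≠ 0 := by
  obtain ⟨v, hv⟩ := exists_nonneg_of_mem_suppP0 hl
  intro h0
  have h1 := h.sub_apply_of_nonneg hv
  rw [h0, Pi.zero_apply] at h1
  linarith

/-- The associated cycle of an exponent of `P_0` is anti-nef. -/
theorem IsElliptic.antinef_of_isAssociatedCycle (hΓ : Γ.IsElliptic) {l l' : V → ℚ}
    (hl : l ∈ Γ.suppP0) (h : Γ.IsAssociatedCycle l l') (v : V) :
    Γ.form l' (Γ.baseE v) ≤ 0 := by
  classical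
  have hx0 : 0 ≤ Γ.canonicalCycle - l' := sub_nonneg.2 h.2.2.1
  -- At negative vertices $Z_K-l'$ vanishes, so $(l',E_v)\le(Z_K,E_v)\le0$. At the others, $l'$ is
  -- the anti-nef cycle $Z_K-E-\ell$ minus an effective cycle avoiding `v`.
  by_cases hv : l v < 0
  · have h1 := Γ.form_baseE_nonneg hx0 (h.2.2.2.1 v hv)
    have h2 := hΓ.form_canonicalCycle_nonpos v
    rw [form_sub_left] at h1
    linarith
  · have h1 := antinef_of_mem_suppP0 hl v
    obtain ⟨-, -, -, -, m, hm⟩ := h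
    have hn0 : 0 ≤ ∑ w with w ∈ Γ.negVertices l, (m w : ℚ) • Γ.baseE w :=
      Finset.sum_nonneg fun w _ => smul_nonneg (Nat.cast_nonneg _) (by simp [baseE])
    have hnv : (∑ w with w ∈ Γ.negVertices l, (m w : ℚ) • Γ.baseE w) v = 0 := by
      rw [Finset.sum_apply]
      refine Finset.sum_eq_zero fun w hw => ?_
      have hwv : v ≠ w := by
        rintro rfl
        exact hv (Finset.mem_filter.1 hw).2
      simp [baseE, hwv]
    have h2 := Γ.form_baseE_nonneg hn0 hnv
    have heq : Γ.canonicalCycle - Γ.sumE - l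
        = l' + ∑ w with w ∈ Γ.negVertices l, (m w : ℚ) • Γ.baseE w := by
      nth_rewrite 1 [hm]
      abel
    rw [heq, form_add_left] at h1
    linarith

theorem IsElliptic.exists_eq_ellC (hΓ : Γ.IsElliptic) {l l' : V → ℚ} (hl : l ∈ Γ.suppP0)
    (h : Γ.IsAssociatedCycle l l') :
    ∃ j ∈ Set.Icc (-1 : ℤ) ((Γ.ellLast : ℤ) - 1), l' = Γ.ellC j := by
  have hanti := hΓ.antinef_of_isAssociatedCycle hl h
  have hx0 : 0 ≤ Γ.canonicalCycle - l' := sub_nonneg.2 h.2.2.1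
  have hxL : Γ.canonicalCycle - l' ∈ Γ.L := by
    have := Γ.L.neg_mem h.2.1
    rwa [neg_sub] at this
  have hx : Γ.IsSupportCanonical (Γ.canonicalCycle - l') :=
    ⟨hxL, hx0, hΓ.form_eq_zero hxL hx0 fun v _ => by rw [sub_sub_cancel]; exact hanti v⟩
  obtain ⟨k, hk⟩ := hΓ.exists_eq_ellRem hx
    (sub_le_sub_left (hΓ.isLeast_minRep.2 ⟨h.1, h.2.1, hanti⟩) _)
  have hkm : k ≤ Γ.ellLast := hΓ.le_ellLast (hk ▸ h.sub_ne_zero hl)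
  refine ⟨(k : ℤ) - 1, ⟨by omega, by omega⟩, ?_⟩
  rw [ellC_eq, ← hk, sub_sub_cancel]

end PlumbingTree

theorem theorem4p2 {V : Type*} [Fintype V] [DecidableEq V] (Γ : PlumbingTree V)
    (hΓ : Γ.IsElliptic) :
    (∀ l ∈ Γ.suppP0, ∃! l' : V → ℚ, Γ.IsAssociatedCycle l l') ∧
    (∀ l ∈ Γ.suppP0, ∀ l' : V → ℚ, Γ.IsAssociatedCycle l l' →
      ∃ j ∈ Set.Icc (-1 : ℤ) ((Γ.ellLast : ℤ) - 1), l' = Γ.ellC j) ∧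
    (∀ j ∈ Set.Icc (-1 : ℤ) ((Γ.ellLast : ℤ) - 1), ∀ l ∈ Γ.suppP0At j,
      Γ.negVertices l = Set.univ \ Γ.ellB (j + 1)) ∧
    (Γ.suppP0 = ⋃ j ∈ Set.Icc (-1 : ℤ) ((Γ.ellLast : ℤ) - 1), Γ.suppP0At j) ∧
    (Set.Icc (-1 : ℤ) ((Γ.ellLast : ℤ) - 1)).PairwiseDisjoint Γ.suppP0At := by
  have hindex : ∀ j ∈ Set.Icc (-1 : ℤ) ((Γ.ellLast : ℤ) - 1), ∃ k : ℕ, j = (k : ℤ) - 1 :=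
    fun j hj => ⟨(j + 1).toNat, by have := hj.1; omega⟩
  have hsub : ∀ k : ℕ, Γ.canonicalCycle - Γ.ellC ((k : ℤ) - 1) = Γ.ellRem k := fun k => by
    rw [Γ.ellC_eq, sub_sub_cancel]
  refine ⟨fun l hl => ?_, fun l hl l' h => hΓ.exists_eq_ellC hl h, fun j hj l hl => ?_, ?_, ?_⟩
  · obtain ⟨l', h⟩ := PlumbingTree.exists_isAssociatedCycle (PlumbingTree.mem_L_of_mem_suppP0 hl)
    exact ⟨l', h, fun y hy => hy.unique h⟩
  · obtain ⟨k, rfl⟩ := hindex j hj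
    rw [hl.2.negVertices_eq, hsub, sub_add_cancel, Γ.ellB_natCast]
  · ext l
    simp only [Set.mem_iUnion, exists_prop]
    constructor
    · intro hl
      obtain ⟨l', h⟩ :=
        PlumbingTree.exists_isAssociatedCycle (PlumbingTree.mem_L_of_mem_suppP0 hl)
      obtain ⟨j, hj, rfl⟩ := hΓ.exists_eq_ellC hl h
      exact ⟨j, hj, hl, h⟩
    · rintro ⟨j, -, hl, -⟩
      exact hl
  · intro i hi j hj hij
    refine Set.disjoint_left.2 fun l hli hlj => hij ?_
    obtain ⟨a, rfl⟩ := hindex i hi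
    obtain ⟨b, rfl⟩ := hindex j hj
    -- A common exponent gives equal, non-zero remainders, and strict decrease separates non-zero
    -- remainders of different index.
    have heq := hli.2.unique hlj.2
    have hne := hli.2.sub_ne_zero hli.1
    rw [hsub] at hne
    have hrem : Γ.ellRem a = Γ.ellRem b := by rw [← hsub a, ← hsub b, heq]
    rw [hΓ.ellRem_injective hne hrem]
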